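/- Let $\ell, m, n$ be positive integers, let $N$ be a nonempty $C^\infty$ manifold of dimension $n$ (without boundary, Hausdorff, second countable), let $U\subset\mathbb{R}^m$ be open, let $f:N\to U$ be an injective $C^\infty$ map, and let $F:U\to\mathbb{R}^\ell$ be a $C^\infty$ map. For a linear map $\pi:\mathbb{R}^m\to\mathbb{R}^\ell$ put $F_\pi=F+\pi|_U$. For $s\ge 1$ let $N^{(s)}=\{(q_1,\dots,q_s)\in N^s \mid q_i\neq q_j \text{ for } i\neq j\}$, an open submanifold of $N^s$; for $g:N\to\mathbb{R}^\ell$ let $g^{(s)}:N^{(s)}\to(\mathbb{R}^\ell)^s$, $g^{(s)}(q_1,\dots,q_s)=(g(q_1),\dots,g(q_s))$; and let $\Delta_s=\{(y,\dots,y)\mid y\in\mathbb{R}^\ell\}\subset(\mathbb{R}^\ell)^s$. A $C^\infty$ map $g:N\to\mathbb{R}^\ell$ is called a mapping with normal crossings if for every integer $s\ge 2$ the map $g^{(s)}$ is transverse to $\Delta_s$, i.e. for each $q\in N^{(s)}$ with $g^{(s)}(q)\in\Delta_s$ one has $$d(g^{(s)})_q(T_qN^{(s)})+T_{g^{(s)}(q)}\Delta_s=T_{g^{(s)}(q)}(\mathbb{R}^\ell)^s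 .$$ Let $$s_f=\max\Big\{s\ge 1 \;\Big|\; \forall (q_1,\dots,q_s)\in N^{(s)}:\ \dim\sum_{i=2}^s\mathbb{R}\,\big(f(q_i)-f(q_1)\big)=s-1\Big\}$$ (this maximum exists, and $2\le s_f\le m+1$). If $(s_f-1)\ell>n\,s_f$, then there is a set $\Sigma$ of linear maps $\mathbb{R}^m\to\mathbb{R}^\ell$, of Lebesgue measure zero in $\mathcal{L}(\mathbb{R}^m,\mathbb{R}^\ell)\cong(\mathbb{R}^m)^\ell$, such that for every $\pi\in\mathcal{L}(\mathbb{R}^m,\mathbb{R}^\ell)\setminus\Sigma$ the map $F_\pi\circ f:N\to\mathbb{R}^\ell$ is a mapping with normal crossings and satisfies $$(F_\pi\circ f)^{(s_f)}(N^{(s_f)})\cap\Delta_{s_f}=\emptyset .$$ -/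

import Mathlib

open Set Function MeasureTheory
open scoped Manifold ContDiff

/-- The set `N^(s)` of `s`-tuples of pairwise distinct points, as a subset of the product `N^s`. -/
def distinctTuples (N : Type*) (s : ℕ) : Set (Fin s → N) :=
  {q | ∀ i j, i ≠ j → q i ≠ q j}

/-- In a Hausdorff space `N^(s)` is open in `N^s`. Hence it is an open submanifold of the product
manifold, with the same tangent spaces and the same derivatives of maps. -/
theorem isOpen_distinctTuples (N : Type*) [TopologicalSpace N] [T2Space N] (s : ℕ) :
    IsOpen (distinctTuples N s) := by
  have h : distinctTuples N s = ⋂ i, ⋂ j, {q : Fin s → N | i ≠ j → q i ≠ q j} := by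
    ext q
    simp [distinctTuples]
  rw [h]
  refine isOpen_iInter_of_finite fun i => isOpen_iInter_of_finite fun j => ?_
  by_cases hij : i = j
  · simp [hij]
  · simpa [hij] using isOpen_ne_fun (continuous_apply i) (continuous_apply j)

/-- The map `g^(s) : (q_1, …, q_s) ↦ (g q_1, …, g q_s)`, on the whole product `N^s`. -/
def multiMap {N P : Type*} (g : N → P) (s : ℕ) : (Fin s → N) → (Fin s → P) :=
  fun q i => g (q i)

/-- The diagonal `Δ_s = {(y, …, y)}` of `V^s`, for a real vector space `V`.
It is a linear subspace of `V^s`. -/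
def diagonalSubspace (V : Type*) [AddCommGroup V] [Module ℝ V] (s : ℕ) : Submodule ℝ (Fin s → V) where
  carrier := {Y | ∃ y : V, Y = fun _ => y}
  zero_mem' := ⟨0, rfl⟩
  add_mem' := by
    rintro _ _ ⟨a, rfl⟩ ⟨b, rfl⟩
    exact ⟨a + b, rfl⟩
  smul_mem' := by
    rintro c _ ⟨a, rfl⟩
    exact ⟨c • a, rfl⟩

/-- The derivative `dG_q : T_q M → T_{G q} V = V` of a map from a manifold to a normed space. -/
noncomputable def derivAt {E H M V : Type*} [NormedAddCommGroup E] [NormedSpace ℝ E]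
    [TopologicalSpace H] (I : ModelWithCorners ℝ E H) [TopologicalSpace M] [ChartedSpace H M]
    [NormedAddCommGroup V] [NormedSpace ℝ V] (G : M → V) (q : M) : E →L[ℝ] V :=
  mfderiv I 𝓘(ℝ, V) G q

/-- Transversality at the point `q` of a map `G` from a manifold to a normed space `V`, to a linear
subspace `W` of `V`: if `G q ∈ W`, then `dG_q (T_q M) + T_{G q} W = T_{G q} V`.
Here `T_{G q} V = V`, and the tangent space of the linear subspace `W` at each of its points
is `W` itself. -/
def TransverseAt {E H M V : Type*} [NormedAddCommGroup E] [NormedSpace ℝ E] [TopologicalSpace H]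
    (I : ModelWithCorners ℝ E H) [TopologicalSpace M] [ChartedSpace H M]
    [NormedAddCommGroup V] [NormedSpace ℝ V] (G : M → V) (W : Submodule ℝ V) (q : M) : Prop :=
  G q ∈ W →
    LinearMap.range (derivAt I G q).toLinearMap ⊔ W = ⊤

/-- The `n`-dimensional model, and its `s`-fold product, which is the model of `N^s`. -/
noncomputable abbrev prodModel (n s : ℕ) :
    ModelWithCorners ℝ (Fin s → EuclideanSpace ℝ (Fin n))
      (ModelPi fun _ : Fin s => EuclideanSpace ℝ (Fin n)) :=
  ModelWithCorners.pi fun _ : Fin s => 𝓘(ℝ, EuclideanSpace ℝ (Fin n))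

/-- `g : N → ℝ^ℓ` is a mapping with normal crossings: for every `s ≥ 2`, the map
`g^(s) : N^(s) → (ℝ^ℓ)^s` is transverse to `Δ_s`. -/
def HasNormalCrossings (n : ℕ) {ℓ : ℕ} {N : Type*} [TopologicalSpace N]
    [ChartedSpace (EuclideanSpace ℝ (Fin n)) N] (g : N → EuclideanSpace ℝ (Fin ℓ)) : Prop :=
  ∀ s : ℕ, 2 ≤ s → ∀ q ∈ distinctTuples N s,
    TransverseAt (prodModel n s) (multiMap g s) (diagonalSubspace (EuclideanSpace ℝ (Fin ℓ)) s) q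

/-- The number `s_f`: the maximal `s = k + 1` such that for all pairwise distinct
`q_0, …, q_k` in `N` the vectors `f q_i - f q_0`, `i = 1, …, k`, span a space of dimension
`k = s - 1`. (For an injection `f` of a nonempty manifold of positive dimension, the set is
nonempty and bounded by `m + 1`, so that the supremum is a maximum.) -/
noncomputable def sMax {N : Type*} {m : ℕ} (f : N → EuclideanSpace ℝ (Fin m)) : ℕ :=
  sSup {s : ℕ | ∃ k : ℕ, s = k + 1 ∧ ∀ q ∈ distinctTuples N (k + 1),
    Module.finrank ℝ
      (Submodule.span ℝ (range fun i : Fin k => f (q i.succ) - f (q 0))) = k}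

/-- The perturbation `F_π = F + π` of `F` by a linear map `π`. -/
def linPerturb {m ℓ : ℕ} (F : EuclideanSpace ℝ (Fin m) → EuclideanSpace ℝ (Fin ℓ))
    (π : EuclideanSpace ℝ (Fin m) →ₗ[ℝ] EuclideanSpace ℝ (Fin ℓ)) :
    EuclideanSpace ℝ (Fin m) → EuclideanSpace ℝ (Fin ℓ) :=
  fun x => F x + π x

/-- A set of linear maps `ℝ^m → ℝ^ℓ` has Lebesgue measure zero: the set of the matrices
`(α_{ij})` representing its elements is Lebesgue null in `(ℝ^m)^ℓ`. -/
def LebesgueNull {m ℓ : ℕ}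
    (S : Set (EuclideanSpace ℝ (Fin m) →ₗ[ℝ] EuclideanSpace ℝ (Fin ℓ))) : Prop :=
  volume {α : Fin ℓ → Fin m → ℝ | Matrix.toEuclideanLin (Matrix.of α) ∈ S} = 0

/-!
For each `s ≤ s_f` the points `f q_1, …, f q_s` are affinely independent whenever the `q_i` are
distinct, so a linear map `π` can be prescribed arbitrarily on the differences `f q_i - f q_1`.
Hence the map `(q, π) ↦ (F_π (f q_i) - F_π (f q_1))_i` is affine in `π` with surjective linear
part. Such a family has zero as a regular value for almost every `π`
(`measure_affine_nontransverse_eq_zero`), which is transversality of `(F_π ∘ f)^(s)` to the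
diagonal (`measure_nontransverse_eq_zero`). For `s = s_f` the inequality `(s_f - 1) ℓ > n s_f`
leaves no room for transversality at a point of the diagonal, so the diagonal is avoided
(`TransverseAt.notMem_diagonalSubspace`); it is then avoided for all `s ≥ s_f`, where
transversality is vacuous.

The parametric statement rests on Sard's theorem. Solving the affine equation for `π` with a smooth
right inverse of the linear part turns the exceptional parameters into critical values of a smooth
map whose source has in general a larger dimension than its target, so the equidimensional form of
Sard's theorem does not suffice. The general `C^∞` form (`nullCriticalValues`) is proved by
induction on the dimension of the source. Critical points with `dg ≠ 0` are treated by slicing and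
Fubini; those where the first nonvanishing derivative has order `j + 1 ≥ 2` lie on a hypersurface;
those where all derivatives up to the dimension of the source vanish have an image of Hausdorff
dimension less than `1`, by Taylor's estimate.
-/

open Measure Module Topology Filter

/-! ### Null sets, surjective linear maps and straightening of functions -/

/-- `A ↦ μ (g '' A)` is an outer measure, so its null sets can be recognised locally. The source of
`g` need not carry a measure; only second countability is used. -/
theorem measure_image_null_of_locally_null {α β : Type*} [TopologicalSpace α]
    [SecondCountableTopology α] [MeasurableSpace β] {μ : Measure β} {g : α → β} {s : Set α}
    (h : ∀ x ∈ s, ∃ u ∈ 𝓝 x, μ (g '' (s ∩ u)) = 0) : μ (g '' s) = 0 := by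
  refine measure_null_of_locally_null (μ := OuterMeasure.comap g μ.toOuterMeasure) s fun x hx => ?_
  obtain ⟨u, hu, h0⟩ := h x hx
  exact ⟨s ∩ u, inter_mem self_mem_nhdsWithin (mem_nhdsWithin_of_mem_nhds hu), h0⟩

theorem ContDiffAt.iteratedFDeriv_smooth {E F : Type*} [NormedAddCommGroup E] [NormedSpace ℝ E]
    [NormedAddCommGroup F] [NormedSpace ℝ F] {g : E → F} {x : E} (hg : ContDiffAt ℝ ∞ g x) (j : ℕ) :
    ContDiffAt ℝ ∞ (iteratedFDeriv ℝ j g) x :=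
  hg.iteratedFDeriv_right (by exact_mod_cast le_top (a := (⊤ : ℕ∞) + j))

section FiniteDimensional

variable {E F : Type*} [NormedAddCommGroup E] [NormedSpace ℝ E] [FiniteDimensional ℝ E]
  [NormedAddCommGroup F] [NormedSpace ℝ F] [FiniteDimensional ℝ F]

omit [FiniteDimensional ℝ E] in
theorem ContinuousLinearMap.exists_rightInverse_of_finiteDimensional {A : E →L[ℝ] F}
    (hA : Surjective A) : ∃ R : F →L[ℝ] E, A.comp R = ContinuousLinearMap.id ℝ F := by
  obtain ⟨R, hR⟩ := A.toLinearMap.exists_rightInverse_of_surjective (LinearMap.range_eq_top.2 hA)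
  refine ⟨R.toContinuousLinearMap, ContinuousLinearMap.ext fun x => ?_⟩
  exact LinearMap.congr_fun hR x

omit [FiniteDimensional ℝ E] in
/-- If `A ∘ R = 1`, then `B ∘ R` remains invertible for `B` near `A`. -/
theorem ContinuousLinearMap.isOpen_setOf_surjective_of_finiteDimensional :
    IsOpen {A : E →L[ℝ] F | Surjective A} := by
  rw [isOpen_iff_mem_nhds]
  intro A hA
  obtain ⟨R, hR⟩ := A.exists_rightInverse_of_finiteDimensional hA
  have hc : Continuous fun B : E →L[ℝ] F => B.comp R := by fun_prop
  have hu : {B : F →L[ℝ] F | IsUnit B} ∈ 𝓝 (A.comp R) := by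
    refine Units.isOpen.mem_nhds ?_
    rw [hR]
    exact isUnit_one
  filter_upwards [hc.continuousAt.preimage_mem_nhds hu] with B hB y
  obtain ⟨C, hC⟩ := IsUnit.exists_right_inv (show IsUnit (B.comp R) from hB)
  exact ⟨R (C y), DFunLike.congr_fun hC y⟩

end FiniteDimensional

/-- Near a point where `dw ≠ 0` there are smooth coordinates `(t, k) ∈ ℝ × K` in which `w` is the
first coordinate: `ψ` is the inverse of the local diffeomorphism `x ↦ (w x, P x)`, where `P` is a
projection onto `K = ker dw`. Smoothness of class `C^∞` at a single point does not propagate to a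
neighbourhood, so `w` is assumed smooth on an open set. -/
theorem exists_straightening {E : Type*} [NormedAddCommGroup E] [NormedSpace ℝ E]
    [FiniteDimensional ℝ E] {U : Set E} (hU : IsOpen U) {w : E → ℝ} (hw : ContDiffOn ℝ ∞ w U)
    {x₀ : E} (hx₀U : x₀ ∈ U) (hd : fderiv ℝ w x₀ ≠ 0) :
    ∃ (K : Submodule ℝ E) (V : Set (ℝ × K)) (ψ : ℝ × K → E), finrank ℝ K < finrank ℝ E ∧
      IsOpen V ∧ MapsTo ψ V U ∧ ContDiffOn ℝ ∞ ψ V ∧ (∀ p ∈ V, w (ψ p) = p.1) ∧ ψ '' V ∈ 𝓝 x₀ := by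
  set D := fderiv ℝ w x₀ with hD
  have hDs : Surjective D.toLinearMap :=
    LinearMap.surjective (f := D.toLinearMap) (by
      intro h; exact hd (ContinuousLinearMap.coe_injective h))
  set K : Submodule ℝ E := D.toLinearMap.ker with hK
  obtain ⟨P, hP⟩ := LinearMap.exists_leftInverse_of_injective K.subtype (Submodule.ker_subtype K)
  let Pc : E →L[ℝ] K := P.toContinuousLinearMap
  have hPc : ∀ k : K, Pc k = k := fun k => LinearMap.congr_fun hP k
  have hrank : finrank ℝ K + 1 = finrank ℝ E := by
    have := D.toLinearMap.finrank_range_add_finrank_ker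
    rw [LinearMap.range_eq_top.2 hDs, finrank_top, finrank_self] at this
    exact (add_comm _ _).trans this
  let e : E → ℝ × K := fun x => (w x, Pc x)
  let A : E →L[ℝ] ℝ × K := D.prod Pc
  have hAinj : Injective A.toLinearMap := by
    rw [← LinearMap.ker_eq_bot, LinearMap.ker_eq_bot']
    intro x hx
    have h1 : D x = 0 := congrArg Prod.fst hx
    have h2 : Pc x = 0 := congrArg Prod.snd hx
    have h3 := hPc ⟨x, h1⟩
    rw [h2] at h3
    exact congrArg Subtype.val h3.symm
  have hfr : finrank ℝ E = finrank ℝ (ℝ × K) := by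
    rw [finrank_prod, finrank_self]; omega
  let A' : E ≃L[ℝ] ℝ × K :=
    (LinearEquiv.ofInjectiveOfFinrankEq A.toLinearMap hAinj hfr).toContinuousLinearEquiv
  have heU : ∀ x ∈ U, ContDiffAt ℝ ∞ e x := fun x hx =>
    (hw.contDiffAt (hU.mem_nhds hx)).prodMk Pc.contDiff.contDiffAt
  have he := heU x₀ hx₀U
  have hA' : HasFDerivAt e (A' : E →L[ℝ] ℝ × K) x₀ := by
    have h1 : HasFDerivAt e A x₀ :=
      ((hw.contDiffAt (hU.mem_nhds hx₀U)).differentiableAt (by simp)).hasFDerivAt.prodMk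
        Pc.hasFDerivAt
    exact h1
  let φ := he.toOpenPartialHomeomorph e hA' (by simp)
  have hx₀ : x₀ ∈ φ.source := he.mem_toOpenPartialHomeomorph_source hA' (by simp)
  have hinv : {x | x ∈ U ∧ fderiv ℝ e x ∈ range ((↑) : (E ≃L[ℝ] ℝ × K) → E →L[ℝ] ℝ × K)} ∈
      𝓝 x₀ := by
    refine inter_mem (hU.mem_nhds hx₀U) ?_
    have hc := (he.fderiv_right (m := 0) (by simp)).continuousAt
    rw [ContinuousAt, hA'.fderiv] at hc
    exact hc A'.nhds
  have hsymm : φ.symm (e x₀) = x₀ := φ.left_inv hx₀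
  have hev : {p | p ∈ φ.target ∧ φ.symm p ∈ U ∧ ContDiffAt ℝ ∞ φ.symm p} ∈ 𝓝 (e x₀) := by
    have ht' : e x₀ ∈ φ.symm.source := φ.map_source hx₀
    have ht := φ.open_target.mem_nhds ht'
    rw [← hsymm] at hinv
    filter_upwards [ht, (φ.symm.continuousAt ht').preimage_mem_nhds hinv] with p hp hpi
    obtain ⟨hpU, B, hB⟩ := hpi
    refine ⟨hp, hpU, φ.contDiffAt_symm (f₀' := B) hp ?_ (heU _ hpU)⟩
    rw [hB]
    exact ((heU _ hpU).differentiableAt (by simp)).hasFDerivAt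
  obtain ⟨V, hVsub, hVo, hxV⟩ := mem_nhds_iff.1 hev
  refine ⟨K, V, φ.symm, by omega, hVo, fun p hp => (hVsub hp).2.1,
    fun p hp => (hVsub hp).2.2.contDiffWithinAt, ?_, ?_⟩
  · intro p hp
    exact congrArg Prod.fst (φ.right_inv (hVsub hp).1)
  · rw [φ.symm.image_eq_target_inter_inv_preimage (fun p hp => (hVsub hp).1)]
    exact inter_mem (φ.open_source.mem_nhds hx₀)
      (φ.continuousAt hx₀ |>.preimage_mem_nhds (hVo.mem_nhds hxV))

/-! ### Flat points of smooth maps -/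

theorem norm_sub_le_of_norm_fderiv_le_pow {E G : Type*} [NormedAddCommGroup E] [NormedSpace ℝ E]
    [NormedAddCommGroup G] [NormedSpace ℝ G] {h : E → G} {s : Set E} (hs : Convex ℝ s) {M : ℝ}
    (hM : 0 ≤ M) {j : ℕ} {x y : E} (hx : x ∈ s) (hy : y ∈ s)
    (hd : ∀ z ∈ s, DifferentiableAt ℝ h z)
    (hb : ∀ z ∈ s, ‖fderiv ℝ h z‖ ≤ M * ‖z - x‖ ^ j) :
    ‖h y - h x‖ ≤ M * ‖y - x‖ ^ (j + 1) := by
  have := (hs.inter (convex_closedBall x ‖y - x‖)).norm_image_sub_le_of_norm_fderiv_le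
    (𝕜 := ℝ) (f := h) (C := M * ‖y - x‖ ^ j) (x := x) (y := y) (fun z hz => hd z hz.1) ?_
    ⟨hx, by simp⟩ ⟨hy, by simp [dist_eq_norm]⟩
  · rwa [pow_succ, ← mul_assoc]
  · rintro z ⟨hz, hz'⟩
    rw [Metric.mem_closedBall, dist_eq_norm] at hz'
    exact (hb z hz).trans (by gcongr)

section Sard

variable {E F : Type*} [NormedAddCommGroup E] [NormedSpace ℝ E]
  [NormedAddCommGroup F] [NormedSpace ℝ F]

/-- Taylor's estimate at a point where all derivatives of orders `1, …, k` vanish, obtained by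
integrating the bound on the derivative of order `k + 1` back, one order at a time. -/
theorem norm_sub_le_of_iteratedFDeriv_eq_zero {g : E → F} {s : Set E} (hs : Convex ℝ s)
    (hg : ∀ z ∈ s, ContDiffAt ℝ ∞ g z) {k : ℕ} {M : ℝ} (hM : 0 ≤ M)
    (hb : ∀ z ∈ s, ‖iteratedFDeriv ℝ (k + 1) g z‖ ≤ M) {x y : E} (hx : x ∈ s) (hy : y ∈ s)
    (hx0 : ∀ j ∈ Finset.Icc 1 k, iteratedFDeriv ℝ j g x = 0) :
    ‖g y - g x‖ ≤ M * ‖y - x‖ ^ (k + 1) := by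
  have key : ∀ j ≤ k, ∀ z ∈ s, ‖iteratedFDeriv ℝ (k - j + 1) g z‖ ≤ M * ‖z - x‖ ^ j := by
    intro j
    induction j with
    | zero => simpa using hb
    | succ j ih =>
      intro hj z hz
      have e : k - (j + 1) + 1 = k - j := by omega
      have h0 := hx0 (k - j) (Finset.mem_Icc.2 ⟨by omega, by omega⟩)
      rw [e]
      have := norm_sub_le_of_norm_fderiv_le_pow hs hM hx hz (h := iteratedFDeriv ℝ (k - j) g)
        (j := j) (fun y hy => ((hg y hy).iteratedFDeriv_smooth _).differentiableAt (by simp))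
        (fun y hy => by rw [norm_fderiv_iteratedFDeriv]; exact ih (by omega) y hy)
      rwa [h0, sub_zero] at this
  refine norm_sub_le_of_norm_fderiv_le_pow hs hM hx hy
    (fun z hz => (hg z hz).differentiableAt (by simp)) fun z hz => ?_
  have := key k le_rfl z hz
  rw [Nat.sub_self, zero_add] at this
  rwa [← norm_iteratedFDeriv_one]

variable [FiniteDimensional ℝ E] [FiniteDimensional ℝ F] [MeasurableSpace F] [BorelSpace F]

/-- The flat part of Sard's theorem. On the set where the derivatives of orders `1, …, k` vanish,
`g` is locally Hölder with exponent `k + 1 > dim E`, so the image has Hausdorff dimension less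
than `1 ≤ dim F`. -/
theorem measure_image_flat_eq_zero [Nontrivial F] {U : Set E} (hU : IsOpen U) {g : E → F}
    (hg : ContDiffOn ℝ ∞ g U) {k : ℕ} (hk : finrank ℝ E ≤ k) (μ : Measure F)
    [μ.IsAddHaarMeasure] :
    μ (g '' {x | x ∈ U ∧ ∀ j ∈ Finset.Icc 1 k, iteratedFDeriv ℝ j g x = 0}) = 0 := by
  refine measure_image_null_of_locally_null fun x₀ hx₀ => ?_
  have hgU : ∀ z ∈ U, ContDiffAt ℝ ∞ g z := fun z hz => hg.contDiffAt (hU.mem_nhds hz)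
  have hc : ContinuousAt (fun z => ‖iteratedFDeriv ℝ (k + 1) g z‖) x₀ :=
    ((hgU x₀ hx₀.1).iteratedFDeriv_smooth _).continuousAt.norm
  set M := ‖iteratedFDeriv ℝ (k + 1) g x₀‖ + 1 with hMdef
  have hM : 0 ≤ M := by positivity
  have hev : {z | z ∈ U ∧ ‖iteratedFDeriv ℝ (k + 1) g z‖ < M} ∈ 𝓝 x₀ :=
    inter_mem (hU.mem_nhds hx₀.1) (hc.eventually_lt_const (by simp [hMdef]))
  obtain ⟨r, hr, hball⟩ := Metric.mem_nhds_iff.1 hev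
  refine ⟨Metric.ball x₀ r, Metric.ball_mem_nhds x₀ hr, ?_⟩
  set S := {x | x ∈ U ∧ ∀ j ∈ Finset.Icc 1 k, iteratedFDeriv ℝ j g x = 0} ∩ Metric.ball x₀ r
  have hH : HolderOnWith M.toNNReal (k + 1) g S := by
    intro x hx y hy
    have := norm_sub_le_of_iteratedFDeriv_eq_zero (convex_ball x₀ r)
      (fun z hz => hgU z (hball hz).1) hM (fun z hz => (hball hz).2.le) hy.2 hx.2 hy.1.2
    rw [edist_nndist, edist_nndist]
    have h2 : ((k + 1 : NNReal) : ℝ) = ((k + 1 : ℕ) : ℝ) := by push_cast; ring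
    rw [h2, ENNReal.rpow_natCast]
    norm_cast
    rw [← NNReal.coe_le_coe]
    push_cast
    rwa [Real.coe_toNNReal _ hM, dist_eq_norm, dist_eq_norm]
  have hdim : dimH (g '' S) < (1 : NNReal) := by
    calc dimH (g '' S) ≤ dimH S / ((k + 1 : NNReal)) := hH.dimH_image_le (by positivity)
      _ ≤ (finrank ℝ E : ENNReal) / (k + 1 : NNReal) := by
        gcongr
        rw [← Real.dimH_univ_eq_finrank E]
        exact dimH_mono (subset_univ _)
      _ < 1 := by
        rw [ENNReal.div_lt_iff (by simp) (by simp), one_mul]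
        exact_mod_cast Nat.lt_succ_of_le hk
  have h1 : (1 : NNReal) ≤ (finrank ℝ F : NNReal) := by
    exact_mod_cast (finrank_pos : 0 < finrank ℝ F)
  have hnull : μH[(finrank ℝ F : NNReal)] (g '' S) = 0 :=
    hausdorffMeasure_of_dimH_lt (hdim.trans_le (by exact_mod_cast h1))
  rw [NNReal.coe_natCast] at hnull
  rw [isAddLeftInvariant_eq_smul μ μH[finrank ℝ F], Measure.smul_apply, hnull, smul_zero]

end Sard

/-! ### Sard's theorem -/

/-- The assertion of Sard's theorem for smooth maps from open subsets of `E` to `F`: the critical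
values form a null set for every additive Haar measure. -/
def NullCriticalValues (E F : Type*) [NormedAddCommGroup E] [NormedSpace ℝ E]
    [NormedAddCommGroup F] [NormedSpace ℝ F] [MeasurableSpace F] : Prop :=
  ∀ (μ : Measure F) [μ.IsAddHaarMeasure] (U : Set E) (g : E → F), IsOpen U → ContDiffOn ℝ ∞ g U →
    μ (g '' {x | x ∈ U ∧ ¬Surjective (fderiv ℝ g x)}) = 0

section Sard

variable {E F : Type*} [NormedAddCommGroup E] [NormedSpace ℝ E]
  [NormedAddCommGroup F] [NormedSpace ℝ F]

variable [FiniteDimensional ℝ E] [FiniteDimensional ℝ F] [MeasurableSpace F] [BorelSpace F]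

omit [FiniteDimensional ℝ F] [BorelSpace F] in
/-- Locally, the points where `dg = 0`, the derivative of order `j` vanishes and that of order
`j + 1` does not are contained in a smooth hypersurface, the zero set of a component of the
derivative of order `j`. They remain critical for the restriction of `g` to it, so the dimension
drops. -/
theorem measure_image_jump_eq_zero [Nontrivial F] {U : Set E} (hU : IsOpen U) {g : E → F}
    (hg : ContDiffOn ℝ ∞ g U) (μ : Measure F) [μ.IsAddHaarMeasure] (j : ℕ)
    (ih : ∀ K : Submodule ℝ E, finrank ℝ K < finrank ℝ E → NullCriticalValues K F) :
    μ (g '' {x | x ∈ U ∧ fderiv ℝ g x = 0 ∧ iteratedFDeriv ℝ j g x = 0 ∧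
      iteratedFDeriv ℝ (j + 1) g x ≠ 0}) = 0 := by
  refine measure_image_null_of_locally_null fun x₀ ⟨hx₀U, hx₀1, hx₀j, hx₀j'⟩ => ?_
  have hgU : ∀ z ∈ U, ContDiffAt ℝ ∞ g z := fun z hz => hg.contDiffAt (hU.mem_nhds hz)
  have hit : ∀ z ∈ U, ContDiffAt ℝ ∞ (iteratedFDeriv ℝ j g) z := fun z hz =>
    (hgU z hz).iteratedFDeriv_smooth j
  have hne : fderiv ℝ (iteratedFDeriv ℝ j g) x₀ ≠ 0 := by
    intro h
    refine hx₀j' (norm_eq_zero.1 (norm_fderiv_iteratedFDeriv.symm.trans ?_))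
    rw [h]
    exact ContinuousLinearMap.opNorm_zero
  obtain ⟨v, hv⟩ := DFunLike.ne_iff.1 hne
  obtain ⟨φ, -, hφ⟩ := exists_dual_vector ℝ (fderiv ℝ (iteratedFDeriv ℝ j g) x₀ v)
    (norm_ne_zero_iff.2 hv)
  obtain ⟨K, V, ψ, hK, hV, hVU, hψ, hw, hnhds⟩ := exists_straightening hU
    (w := fun x => φ (iteratedFDeriv ℝ j g x))
    (fun z hz => (φ.contDiff.contDiffAt.comp z (hit z hz)).contDiffWithinAt) hx₀U (by
      intro h
      have h1 := fderiv_comp x₀ φ.differentiableAt ((hit x₀ hx₀U).differentiableAt (by simp))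
      have h2 := DFunLike.congr_fun (h1.symm.trans h) v
      rw [φ.fderiv] at h2
      have h3 : φ (fderiv ℝ (iteratedFDeriv ℝ j g) x₀ v) = 0 := h2
      rw [hφ] at h3
      exact norm_ne_zero_iff.2 hv (by simpa using h3))
  refine ⟨ψ '' V, hnhds, measure_mono_null ?_ (ih K hK μ ((fun k : K => ((0 : ℝ), k)) ⁻¹' V)
    (fun k => g (ψ (0, k))) (hV.preimage (by fun_prop)) ?_)⟩
  · rintro _ ⟨x, ⟨⟨hxU, hx1, hxj, -⟩, p, hp, rfl⟩, rfl⟩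
    have hp0 : p.1 = 0 := by
      rw [← hw p hp, hxj, map_zero]
    obtain ⟨t, k⟩ := p
    obtain rfl : t = 0 := hp0
    refine ⟨k, ⟨hp, ?_⟩, rfl⟩
    have hd : DifferentiableAt ℝ (fun k : K => ψ (0, k)) k :=
      ((hψ.contDiffAt (hV.mem_nhds hp)).differentiableAt (by simp)).comp k (by fun_prop)
    have h1 := fderiv_comp k ((hgU _ hxU).differentiableAt (by simp)) hd
    rw [hx1, ContinuousLinearMap.zero_comp] at h1
    rw [show (fun k : K => g (ψ (0, k))) = g ∘ fun k : K => ψ (0, k) from rfl, h1]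
    intro hs
    obtain ⟨y, hy⟩ := exists_ne (0 : F)
    obtain ⟨z, hz⟩ := hs y
    exact hy hz.symm
  · exact (hg.comp hψ hVU).comp (t := V) (by fun_prop) fun k hk => hk

/-- The critical points at which `dg ≠ 0`. In coordinates in which some functional `φ ∘ g` is the
first coordinate, `g` maps the slices of the source to the translates of `ker φ`; by induction the
critical values in each translate are null, and Fubini's theorem concludes. -/
theorem measure_image_nonzero_eq_zero {U : Set E} (hU : IsOpen U) {g : E → F}
    (hg : ContDiffOn ℝ ∞ g U) (μ : Measure F) [μ.IsAddHaarMeasure]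
    (ih : ∀ K : Submodule ℝ E, finrank ℝ K < finrank ℝ E → ∀ F' : Submodule ℝ F,
      NullCriticalValues K F') :
    μ (g '' {x | x ∈ U ∧ ¬Surjective (fderiv ℝ g x) ∧ fderiv ℝ g x ≠ 0}) = 0 := by
  refine measure_image_null_of_locally_null fun x₀ ⟨hx₀U, hx₀s, hx₀⟩ => ?_
  have hgU : ∀ z ∈ U, ContDiffAt ℝ ∞ g z := fun z hz => hg.contDiffAt (hU.mem_nhds hz)
  obtain ⟨v, hv⟩ := DFunLike.ne_iff.1 hx₀
  obtain ⟨φ, -, hφ⟩ := exists_dual_vector ℝ (fderiv ℝ g x₀ v) (norm_ne_zero_iff.2 hv)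
  have hφg : ∀ z ∈ U, fderiv ℝ (fun x => φ (g x)) z = φ.comp (fderiv ℝ g z) := fun z hz => by
    have h1 := fderiv_comp z φ.differentiableAt ((hgU z hz).differentiableAt (by simp))
    rwa [φ.fderiv] at h1
  obtain ⟨K, V, ψ, hK, hV, hVU, hψ, hw, hnhds⟩ := exists_straightening hU
    (w := fun x => φ (g x))
    (fun z hz => (φ.contDiff.contDiffAt.comp z (hgU z hz)).contDiffWithinAt) hx₀U (by
      intro h
      rw [hφg x₀ hx₀U] at h
      have h2 : φ (fderiv ℝ g x₀ v) = 0 := DFunLike.congr_fun h v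
      rw [hφ] at h2
      exact norm_ne_zero_iff.2 hv (by simpa using h2))
  obtain ⟨C, hCn, hCsub, hC⟩ := local_compact_nhds hnhds
  -- Fubini needs a measurable set: the critical points in a compact neighbourhood form a compact
  -- set, and so does their image.
  have hCU : C ⊆ U := fun x hx => by
    obtain ⟨p, hp, rfl⟩ := hCsub hx
    exact hVU hp
  set T : Set E := {x | x ∈ C ∧ ¬Surjective (fderiv ℝ g x)} with hT
  have hTc : IsCompact T := by
    have hcont : ContinuousOn (fderiv ℝ g) C :=
      (hg.continuousOn_fderiv_of_isOpen hU (by simp)).mono hCU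
    have := hcont.preimage_isClosed_of_isClosed hC.isClosed
      (ContinuousLinearMap.isOpen_setOf_surjective_of_finiteDimensional
        (E := E) (F := F)).isClosed_compl
    exact hC.of_isClosed_subset this inter_subset_left
  have hTm : MeasurableSet (g '' T) :=
    (hTc.image_of_continuousOn (hg.continuousOn.mono fun x hx => hCU hx.1)).measurableSet
  refine ⟨C, hCn, measure_mono_null (t := g '' T) ?_ ?_⟩
  · rintro _ ⟨x, ⟨⟨hxU, hxs, -⟩, hxC⟩, rfl⟩
    exact ⟨x, ⟨hxC, hxs⟩, rfl⟩
  set F' : Submodule ℝ F := φ.toLinearMap.ker with hF'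
  obtain ⟨P, hP⟩ := LinearMap.exists_leftInverse_of_injective F'.subtype (Submodule.ker_subtype F')
  let Pc : F →L[ℝ] F' := P.toContinuousLinearMap
  have hPc : ∀ k : F', Pc k = k := fun k => LinearMap.congr_fun hP k
  suffices h : ∀ᵐ y ∂μ, y ∈ (g '' T)ᶜ by
    have h' : μ (g '' T)ᶜᶜ = 0 := h
    rwa [compl_compl] at h'
  refine ae_mem_of_ae_add_linearMap_mem F'.subtype (addHaar : Measure F') μ hTm.compl fun y => ?_
  rw [ae_iff]
  -- The slice of `g` over the translate `y + ker φ`, projected to `ker φ`.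
  set G : K → F' := fun k => Pc (g (ψ (φ y, k)) - y) with hG
  refine measure_mono_null ?_ (ih K hK F' addHaar ((fun k : K => (φ y, k)) ⁻¹' V) G
    (hV.preimage (by fun_prop)) ?_)
  · intro z hz
    simp only [mem_ofPred_eq, mem_compl_iff, not_not] at hz
    obtain ⟨x, ⟨hxC, hxs⟩, hxz⟩ := hz
    obtain ⟨⟨t, k⟩, hp, rfl⟩ := hCsub hxC
    have ht : φ y = t := by
      have h1 := hw _ hp
      have h2 : φ z = 0 := z.2
      simp only at h1
      rw [← h1, hxz, map_add, Submodule.coe_subtype, h2, add_zero]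
    subst ht
    refine ⟨k, ⟨hp, fun hs => hxs ?_⟩, ?_⟩
    · have hψd := ((hψ.contDiffAt (hV.mem_nhds hp)).differentiableAt (by simp)).hasFDerivAt
      have hgd := ((hgU _ (hVU hp)).differentiableAt (by simp)).hasFDerivAt
      have hcomp := hgd.comp _ hψd
      set A := (fderiv ℝ g (ψ (φ y, k))).comp (fderiv ℝ ψ (φ y, k)) with hA
      have hφA : ∀ q, φ (A q) = q.1 := by
        have h1 : HasFDerivAt (fun p => φ (g (ψ p))) (φ.comp A) (φ y, k) :=
          φ.hasFDerivAt.comp _ hcomp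
        have h2 : HasFDerivAt (fun p => φ (g (ψ p))) (ContinuousLinearMap.fst ℝ ℝ K) (φ y, k) :=
          hasFDerivAt_fst.congr_of_eventuallyEq
            (Filter.eventuallyEq_of_mem (hV.mem_nhds hp) fun p hp => hw p hp)
        exact fun q => DFunLike.congr_fun (h1.unique h2) q
      have hGd : HasFDerivAt G (Pc.comp (A.comp (ContinuousLinearMap.inr ℝ ℝ K))) k := by
        have h1 : HasFDerivAt (fun k : K => (φ y, k)) (ContinuousLinearMap.inr ℝ ℝ K) k :=
          hasFDerivAt_prodMk_right _ _
        have h2 := (hcomp.comp k h1).sub_const y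
        exact Pc.hasFDerivAt.comp k h2
      rw [hGd.fderiv] at hs
      intro u
      -- Match the `φ`-component of `u` along the first coordinate, the remainder along the slice.
      have hker : u - A (φ u, 0) ∈ F' := by
        change φ (u - A (φ u, 0)) = 0
        rw [map_sub, hφA, sub_self]
      obtain ⟨k', hk'⟩ := hs ⟨_, hker⟩
      have hk0 : A (0, k') ∈ F' := hφA (0, k')
      have hk1 : A (0, k') = u - A (φ u, 0) := by
        have h1 : Pc (A (0, k')) = ⟨_, hk0⟩ := hPc ⟨_, hk0⟩
        exact congrArg Subtype.val (h1.symm.trans hk')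
      refine ⟨fderiv ℝ ψ (φ y, k) (φ u, k'), ?_⟩
      change A (φ u, k') = u
      have h2 : ((φ u, k') : ℝ × K) = (φ u, 0) + (0, k') := by simp
      rw [h2, map_add, hk1, add_sub_cancel]
    · simp only [hG]
      rw [hxz, Submodule.coe_subtype, add_sub_cancel_left, hPc]
  · refine Pc.contDiff.comp_contDiffOn (ContDiffOn.sub ?_ contDiffOn_const)
    exact (hg.comp hψ hVU).comp (t := V) (by fun_prop) fun k hk => hk

end Sard

universe u v

/-- **Sard's theorem** for `C^∞` maps between finite-dimensional spaces of any dimensions, by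
induction on the dimension of the source. -/
theorem nullCriticalValues : ∀ (n : ℕ) (E : Type u) (F : Type v) [NormedAddCommGroup E]
    [NormedSpace ℝ E] [FiniteDimensional ℝ E] [NormedAddCommGroup F] [NormedSpace ℝ F]
    [FiniteDimensional ℝ F] [MeasurableSpace F] [BorelSpace F], finrank ℝ E = n → NullCriticalValues E F := by
  intro n
  induction n using Nat.strong_induction_on with
  | _ n ih =>
  intro E F _ _ _ _ _ _ _ _ hn μ _ U g hU hg
  rcases subsingleton_or_nontrivial F with hF | hF
  · have : {x | x ∈ U ∧ ¬Surjective (fderiv ℝ g x)} = ∅ := by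
      ext x
      simp only [mem_ofPred_eq, mem_empty_iff_false, iff_false, not_and, not_not]
      exact fun _ y => ⟨0, Subsingleton.elim _ _⟩
    rw [this, image_empty, measure_empty]
  have ih' : ∀ K : Submodule ℝ E, finrank ℝ K < finrank ℝ E → ∀ (F' : Type v)
      [NormedAddCommGroup F'] [NormedSpace ℝ F'] [FiniteDimensional ℝ F'] [MeasurableSpace F']
      [BorelSpace F'], NullCriticalValues K F' := fun K hK F' _ _ _ _ _ =>
    ih _ (hn ▸ hK) K F' rfl
  refine measure_mono_null ?_ (measure_union_null
    (measure_image_nonzero_eq_zero hU hg μ fun K hK F' => ih' K hK F')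
    (measure_union_null (measure_image_flat_eq_zero hU hg (hn.le) μ)
      (measure_iUnion_null fun j =>
        measure_image_jump_eq_zero hU hg μ j fun K hK => ih' K hK F)))
  rintro _ ⟨x, ⟨hxU, hxs⟩, rfl⟩
  by_cases hx0 : fderiv ℝ g x = 0
  · right
    by_cases hflat : ∀ j ∈ Finset.Icc 1 n, iteratedFDeriv ℝ j g x = 0
    · exact Or.inl ⟨x, ⟨hxU, hflat⟩, rfl⟩
    · right
      push Not at hflat
      have hex : ∃ j, 1 ≤ j ∧ iteratedFDeriv ℝ j g x ≠ 0 := by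
        obtain ⟨j, hj, hj'⟩ := hflat
        exact ⟨j, (Finset.mem_Icc.1 hj).1, hj'⟩
      classical
      obtain ⟨h1, h2⟩ := Nat.find_spec hex
      have hne1 : Nat.find hex ≠ 1 := by
        intro h
        rw [h, ← norm_ne_zero_iff, norm_iteratedFDeriv_one, hx0, norm_zero] at h2
        exact h2 rfl
      obtain ⟨j, hj⟩ : ∃ j, Nat.find hex = j + 1 := ⟨Nat.find hex - 1, by omega⟩
      have hmin := Nat.find_min hex (m := j) (by omega)
      push Not at hmin
      rw [hj] at h2
      exact mem_iUnion.2 ⟨j, x, ⟨hxU, hx0, hmin (by omega), h2⟩, rfl⟩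
  · exact Or.inl ⟨x, ⟨hxU, hxs, hx0⟩, rfl⟩

/-! ### Transversality of affine families -/

/-- Parametric transversality for families `u ↦ b u + A u a` that depend affinely on the
parameter `a`, with `A u` surjective: for almost every `a`, zero is a regular value. With a smooth
right inverse `R u` of `A u`, the map `Φ (u, a) = a - R u (b u + A u a)` retracts onto the zero set
in each fibre, and the exceptional parameters are critical values of `Φ`. -/
theorem measure_affine_nontransverse_eq_zero {Q L V : Type*}
    [NormedAddCommGroup Q] [NormedSpace ℝ Q] [FiniteDimensional ℝ Q]
    [NormedAddCommGroup L] [NormedSpace ℝ L] [FiniteDimensional ℝ L]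
    [MeasurableSpace L] [BorelSpace L]
    [NormedAddCommGroup V] [NormedSpace ℝ V] [FiniteDimensional ℝ V]
    (μ : Measure L) [μ.IsAddHaarMeasure] {O : Set Q} (hO : IsOpen O) {b : Q → V}
    {A : Q → L →L[ℝ] V} (hb : ContDiffOn ℝ ∞ b O) (hA : ContDiffOn ℝ ∞ A O)
    (hAs : ∀ u ∈ O, Surjective (A u)) :
    μ {a | ∃ u ∈ O, b u + A u a = 0 ∧ ¬Surjective (fderiv ℝ (fun u => b u + A u a) u)} = 0 := by
  have himg : {a | ∃ u ∈ O, b u + A u a = 0 ∧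
      ¬Surjective (fderiv ℝ (fun u => b u + A u a) u)} = Prod.snd '' {p : Q × L | p.1 ∈ O ∧
        b p.1 + A p.1 p.2 = 0 ∧ ¬Surjective (fderiv ℝ (fun u => b u + A u p.2) p.1)} := by
    ext a
    constructor
    · rintro ⟨u, h⟩
      exact ⟨(u, a), h, rfl⟩
    · rintro ⟨⟨u, a⟩, h, rfl⟩
      exact ⟨u, h⟩
  rw [himg]
  refine measure_image_null_of_locally_null fun p₀ hp₀ => ?_
  obtain ⟨R₀, hR₀⟩ := (A p₀.1).exists_rightInverse_of_finiteDimensional (hAs _ hp₀.1)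
  have hAR : ContDiffOn ℝ ∞ (fun u => (A u).comp R₀) O := hA.clm_comp contDiffOn_const
  set O' : Set Q := O ∩ (fun u => (A u).comp R₀) ⁻¹' {B | IsUnit B} with hO'def
  have hO' : IsOpen O' := hAR.continuousOn.isOpen_inter_preimage hO Units.isOpen
  have hp₀' : p₀.1 ∈ O' := ⟨hp₀.1, by
    change IsUnit ((A p₀.1).comp R₀)
    rw [hR₀]
    exact isUnit_one⟩
  set W : Set (Q × L) := O' ×ˢ univ with hWdef
  have hW : IsOpen W := hO'.prod isOpen_univ
  -- A smooth family of right inverses of `A u`, for `u` near `p₀.1`.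
  let R : Q → V →L[ℝ] L := fun u => R₀.comp (Ring.inverse ((A u).comp R₀))
  have hR : ContDiffOn ℝ ∞ R O' := by
    refine contDiffOn_const.clm_comp fun u hu => ?_
    obtain ⟨B, hB⟩ := hu.2
    have h1 := contDiffAt_ringInverse ℝ (n := ∞) B
    rw [hB] at h1
    exact h1.comp_contDiffWithinAt u (hAR.mono inter_subset_left u hu)
  have hAR1 : ∀ u ∈ O', ∀ v, A u (R u v) = v := fun u hu v =>
    DFunLike.congr_fun (Ring.mul_inverse_cancel _ hu.2) v
  let H : Q × L → V := fun p => b p.1 + A p.1 p.2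
  have hfst : MapsTo (Prod.fst : Q × L → Q) W O' := fun p hp => hp.1
  have hH : ContDiffOn ℝ ∞ H W :=
    ((hb.mono inter_subset_left).comp contDiffOn_fst hfst).add
      (((hA.mono inter_subset_left).comp contDiffOn_fst hfst).clm_apply contDiffOn_snd)
  let Φ : Q × L → L := fun p => p.2 - R p.1 (H p)
  have hΦ : ContDiffOn ℝ ∞ Φ W :=
    contDiffOn_snd.sub ((hR.comp contDiffOn_fst hfst).clm_apply hH)
  have hHΦ : ∀ p ∈ W, H (p.1, Φ p) = 0 := fun p hp => by
    simp only [H, Φ, map_sub, hAR1 p.1 hp.1]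
    abel
  refine ⟨W, hW.mem_nhds ⟨hp₀', mem_univ _⟩, measure_mono_null ?_
    (nullCriticalValues _ (Q × L) L rfl μ W Φ hW hΦ)⟩
  rintro _ ⟨⟨u, a⟩, ⟨⟨huO, h0, hns⟩, hpW⟩, rfl⟩
  have hΦp : Φ (u, a) = a := by
    change a - R u (b u + A u a) = a
    simp only at h0
    rw [h0, map_zero, sub_zero]
  refine ⟨(u, a), ⟨hpW, fun hs => hns fun v => ?_⟩, hΦp⟩
  have hHd := ((hH.contDiffAt (hW.mem_nhds hpW)).differentiableAt (by simp)).hasFDerivAt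
  have hΦd := ((hΦ.contDiffAt (hW.mem_nhds hpW)).differentiableAt (by simp)).hasFDerivAt
  set D := fderiv ℝ H (u, a)
  have hD1 : fderiv ℝ (fun u => b u + A u a) u = D.comp (ContinuousLinearMap.inl ℝ Q L) :=
    (HasFDerivAt.comp (f := fun u : Q => (u, a)) u hHd (hasFDerivAt_prodMk_left u a)).fderiv
  have hD2 : A u = D.comp (ContinuousLinearMap.inr ℝ Q L) :=
    ((A u).hasFDerivAt.const_add (b u)).unique
      (HasFDerivAt.comp (f := fun a : L => (u, a)) a hHd (hasFDerivAt_prodMk_right u a))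
  -- Differentiate the identity `H (u, Φ (u, a)) = 0`.
  have hzero : ∀ q, D (q.1, fderiv ℝ Φ (u, a) q) = 0 := by
    have h1 : HasFDerivAt (fun p : Q × L => (p.1, Φ p))
        ((ContinuousLinearMap.fst ℝ Q L).prod (fderiv ℝ Φ (u, a))) (u, a) :=
      hasFDerivAt_fst.prodMk hΦd
    have hHd' : HasFDerivAt H D ((fun p : Q × L => (p.1, Φ p)) (u, a)) := by
      simpa only [hΦp] using hHd
    have h2 := hHd'.comp (u, a) h1
    have h3 : HasFDerivAt (H ∘ fun p : Q × L => (p.1, Φ p)) (0 : Q × L →L[ℝ] V) (u, a) :=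
      (hasFDerivAt_const (0 : V) _).congr_of_eventuallyEq
        (Filter.eventuallyEq_of_mem (hW.mem_nhds hpW) hHΦ)
    exact fun q => DFunLike.congr_fun (h2.unique h3) q
  -- If `dΦ` is onto, a tangent vector on which `A u ∘ dΦ` is `-v` is mapped to `v` by the partial
  -- derivative of `H` in `u`.
  obtain ⟨l, hl⟩ := hAs u huO (-v)
  obtain ⟨q, hq⟩ := hs l
  refine ⟨q.1, ?_⟩
  have h1 := hzero q
  rw [hq] at h1
  have h2 : ((q.1, l) : Q × L) = (q.1, 0) + (0, l) := by simp
  rw [h2, map_add] at h1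
  have h3 : D (0, l) = -v := by
    rw [← hl, hD2]
    rfl
  rw [h3] at h1
  rw [hD1]
  exact add_neg_eq_zero.1 h1

/-! ### Generic linear perturbations on tuples of distinct points -/

section MultiMap

variable {n ℓ : ℕ} {N : Type*} [TopologicalSpace N] [ChartedSpace (EuclideanSpace ℝ (Fin n)) N]

theorem derivAt_multiMap {s : ℕ} {g : N → EuclideanSpace ℝ (Fin ℓ)} {q : Fin s → N}
    (hg : ∀ i, MDifferentiableAt 𝓘(ℝ, EuclideanSpace ℝ (Fin n)) 𝓘(ℝ, EuclideanSpace ℝ (Fin ℓ)) g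
      (q i)) (v : Fin s → EuclideanSpace ℝ (Fin n)) (i : Fin s) :
    derivAt (prodModel n s) (multiMap g s) q v i =
      derivAt 𝓘(ℝ, EuclideanSpace ℝ (Fin n)) g (q i) (v i) := by
  have h : HasMFDerivAt (prodModel n s) 𝓘(ℝ, Fin s → EuclideanSpace ℝ (Fin ℓ)) (multiMap g s) q
      (ContinuousLinearMap.pi fun i =>
        (derivAt 𝓘(ℝ, EuclideanSpace ℝ (Fin n)) g (q i)).comp (ContinuousLinearMap.proj i)) := by
    constructor
    · exact continuousAt_pi.2 fun i => (hg i).continuousAt.comp (f := fun q : Fin s → N => q i)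
        (continuousAt_apply i q)
    · have h1 : ∀ i, HasFDerivAt
          (fun x => g ((extChartAt 𝓘(ℝ, EuclideanSpace ℝ (Fin n)) (q i)).symm x))
          (derivAt 𝓘(ℝ, EuclideanSpace ℝ (Fin n)) g (q i))
          (extChartAt 𝓘(ℝ, EuclideanSpace ℝ (Fin n)) (q i) (q i)) := fun i => by
        have h2 := (hg i).hasMFDerivAt.2
        rw [modelWithCornersSelf_coe, range_id] at h2
        exact hasFDerivWithinAt_univ.1 h2
      have h3 : HasFDerivAt (fun (u : Fin s → EuclideanSpace ℝ (Fin n)) i =>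
            g ((extChartAt 𝓘(ℝ, EuclideanSpace ℝ (Fin n)) (q i)).symm (u i)))
          (ContinuousLinearMap.pi fun i =>
            (derivAt 𝓘(ℝ, EuclideanSpace ℝ (Fin n)) g (q i)).comp (ContinuousLinearMap.proj i))
          (fun i => extChartAt 𝓘(ℝ, EuclideanSpace ℝ (Fin n)) (q i) (q i)) :=
        hasFDerivAt_pi.2 fun i =>
          HasFDerivAt.comp
            (g := fun x => g ((extChartAt 𝓘(ℝ, EuclideanSpace ℝ (Fin n)) (q i)).symm x))
            (f := fun u : Fin s → EuclideanSpace ℝ (Fin n) => u i)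
            (fun i => extChartAt 𝓘(ℝ, EuclideanSpace ℝ (Fin n)) (q i) (q i)) (h1 i)
            (hasFDerivAt_apply i _)
      exact h3.hasFDerivWithinAt
  exact congrFun (DFunLike.congr_fun h.mfderiv v) i

end MultiMap

/-- The linear map with matrix `α`, applied to the vector `x`, as a continuous bilinear map of
`x` and `α`. Matrices are bare functions `Fin ℓ → Fin m → ℝ`, which carry Lebesgue measure. -/
noncomputable def evalMatrix (m ℓ : ℕ) :
    EuclideanSpace ℝ (Fin m) →L[ℝ] (Fin ℓ → Fin m → ℝ) →L[ℝ] EuclideanSpace ℝ (Fin ℓ) :=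
  LinearMap.toContinuousLinearMap (LinearMap.toContinuousLinearMap.toLinearMap ∘ₗ
    (Matrix.toEuclideanLin.toLinearMap ∘ₗ (Matrix.ofLinearEquiv ℝ).toLinearMap :
      (Fin ℓ → Fin m → ℝ) →ₗ[ℝ] EuclideanSpace ℝ (Fin m) →ₗ[ℝ] EuclideanSpace ℝ (Fin ℓ)).flip)

theorem evalMatrix_apply {m ℓ : ℕ} (x : EuclideanSpace ℝ (Fin m)) (α : Fin ℓ → Fin m → ℝ) :
    evalMatrix m ℓ x α = Matrix.toEuclideanLin (Matrix.of α) x :=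
  rfl

/-- A linear map takes arbitrary values on linearly independent vectors. -/
theorem surjective_pi_evalMatrix {m ℓ k : ℕ} {v : Fin k → EuclideanSpace ℝ (Fin m)}
    (hv : LinearIndependent ℝ v) :
    Surjective (ContinuousLinearMap.pi fun i => evalMatrix m ℓ (v i)) := by
  intro y
  obtain ⟨P, hP⟩ := LinearMap.exists_leftInverse_of_injective (Fintype.linearCombination ℝ v)
    (LinearMap.ker_eq_bot.2 hv.fintypeLinearCombination_injective)
  refine ⟨Matrix.of.symm (Matrix.toEuclideanLin.symm (Fintype.linearCombination ℝ y ∘ₗ P)), ?_⟩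
  ext1 i
  have h1 : P (v i) = Pi.single i 1 := by
    have := LinearMap.congr_fun hP (Pi.single i 1)
    simpa [Fintype.linearCombination_apply_single] using this
  rw [ContinuousLinearMap.pi_apply, evalMatrix_apply, Equiv.apply_symm_apply,
    LinearEquiv.apply_symm_apply, LinearMap.comp_apply, h1,
    Fintype.linearCombination_apply_single, one_smul]

section Perturbation

variable {n m ℓ : ℕ} {N : Type*} [TopologicalSpace N] [ChartedSpace (EuclideanSpace ℝ (Fin n)) N]
  [IsManifold 𝓘(ℝ, EuclideanSpace ℝ (Fin n)) ∞ N] {U : Set (EuclideanSpace ℝ (Fin m))}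
  {f : N → EuclideanSpace ℝ (Fin m)}
  {F : EuclideanSpace ℝ (Fin m) → EuclideanSpace ℝ (Fin ℓ)}

omit [IsManifold 𝓘(ℝ, EuclideanSpace ℝ (Fin n)) ∞ N] in
theorem contMDiff_linPerturb_comp (hU : IsOpen U)
    (hf : ContMDiff 𝓘(ℝ, EuclideanSpace ℝ (Fin n)) 𝓘(ℝ, EuclideanSpace ℝ (Fin m)) ∞ f)
    (hfU : ∀ q, f q ∈ U) (hF : ContDiffOn ℝ ∞ F U)
    (π : EuclideanSpace ℝ (Fin m) →ₗ[ℝ] EuclideanSpace ℝ (Fin ℓ)) :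
    ContMDiff 𝓘(ℝ, EuclideanSpace ℝ (Fin n)) 𝓘(ℝ, EuclideanSpace ℝ (Fin ℓ)) ∞
      (linPerturb F π ∘ f) := by
  have h : ContDiffOn ℝ ∞ (linPerturb F π) U :=
    hF.add π.toContinuousLinearMap.contDiff.contDiffOn
  exact fun q => (h.contDiffAt (hU.mem_nhds (hfU q))).contMDiffAt.comp q (hf q)

/-- If `f` maps distinct points to affinely independent ones, `k + 1` at a time, then for almost
every matrix the perturbed map is transverse to the diagonal on `(k + 1)`-tuples. In charts, the
differences of the values of the perturbed map are affine in the matrix, with surjective linear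
part, and transversality to the diagonal says that zero is a regular value of them. -/
theorem measure_nontransverse_eq_zero [T2Space N] [SecondCountableTopology N] (hU : IsOpen U)
    (hf : ContMDiff 𝓘(ℝ, EuclideanSpace ℝ (Fin n)) 𝓘(ℝ, EuclideanSpace ℝ (Fin m)) ∞ f)
    (hfU : ∀ q, f q ∈ U) (hF : ContDiffOn ℝ ∞ F U) {k : ℕ}
    (hind : ∀ q ∈ distinctTuples N (k + 1),
      LinearIndependent ℝ fun i : Fin k => f (q i.succ) - f (q 0)) :
    volume {α : Fin ℓ → Fin m → ℝ | ∃ q ∈ distinctTuples N (k + 1),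
      ¬TransverseAt (prodModel n (k + 1))
        (multiMap (linPerturb F (Matrix.toEuclideanLin (Matrix.of α)) ∘ f) (k + 1))
        (diagonalSubspace (EuclideanSpace ℝ (Fin ℓ)) (k + 1)) q} = 0 := by
  let I := 𝓘(ℝ, EuclideanSpace ℝ (Fin n))
  let G : (Fin ℓ → Fin m → ℝ) → N → EuclideanSpace ℝ (Fin ℓ) := fun α =>
    linPerturb F (Matrix.toEuclideanLin (Matrix.of α)) ∘ f
  have hG : ∀ α, ContMDiff I 𝓘(ℝ, EuclideanSpace ℝ (Fin ℓ)) ∞ (G α) := fun α =>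
    contMDiff_linPerturb_comp hU hf hfU hF _
  have himg : {α : Fin ℓ → Fin m → ℝ | ∃ q ∈ distinctTuples N (k + 1),
      ¬TransverseAt (prodModel n (k + 1)) (multiMap (G α) (k + 1))
        (diagonalSubspace (EuclideanSpace ℝ (Fin ℓ)) (k + 1)) q} =
      Prod.snd '' {p : (Fin (k + 1) → N) × (Fin ℓ → Fin m → ℝ) | p.1 ∈ distinctTuples N (k + 1) ∧
        ¬TransverseAt (prodModel n (k + 1)) (multiMap (G p.2) (k + 1))
          (diagonalSubspace (EuclideanSpace ℝ (Fin ℓ)) (k + 1)) p.1} := by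
    ext α
    constructor
    · rintro ⟨q, h⟩
      exact ⟨(q, α), h, rfl⟩
    · rintro ⟨⟨q, α⟩, h, rfl⟩
      exact ⟨q, h⟩
  change volume {α : Fin ℓ → Fin m → ℝ | ∃ q ∈ distinctTuples N (k + 1),
      ¬TransverseAt (prodModel n (k + 1)) (multiMap (G α) (k + 1))
        (diagonalSubspace (EuclideanSpace ℝ (Fin ℓ)) (k + 1)) q} = 0
  rw [himg]
  refine measure_image_null_of_locally_null fun p₀ _ => ?_
  let e := fun i => extChartAt I (p₀.1 i)
  let φ : (Fin (k + 1) → EuclideanSpace ℝ (Fin n)) → Fin (k + 1) → N :=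
    fun u i => (e i).symm (u i)
  let O₁ : Set (Fin (k + 1) → EuclideanSpace ℝ (Fin n)) := univ.pi fun i => (e i).target
  have hO₁ : IsOpen O₁ := isOpen_set_pi finite_univ fun i _ => isOpen_extChartAt_target _
  have hφ : ContinuousOn φ O₁ := continuousOn_pi.2 fun i =>
    (continuousOn_extChartAt_symm (p₀.1 i)).comp (continuous_apply i).continuousOn
      fun u hu => hu i (mem_univ i)
  let O := O₁ ∩ φ ⁻¹' distinctTuples N (k + 1)
  have hO : IsOpen O := hφ.isOpen_inter_preimage hO₁ (isOpen_distinctTuples N (k + 1))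
  have hfφ : ∀ i, ContDiffOn ℝ ∞ (fun u => f (φ u i)) O := fun i => by
    have h1 : ContDiffOn ℝ ∞ (fun x => f ((e i).symm x)) (e i).target :=
      (hf.comp_contMDiffOn (contMDiffOn_extChartAt_symm (p₀.1 i))).contDiffOn
    exact h1.comp (contDiff_apply _ _ i).contDiffOn fun u hu => hu.1 i (mem_univ i)
  let b : (Fin (k + 1) → EuclideanSpace ℝ (Fin n)) → Fin k → EuclideanSpace ℝ (Fin ℓ) :=
    fun u i => F (f (φ u i.succ)) - F (f (φ u 0))
  let A : (Fin (k + 1) → EuclideanSpace ℝ (Fin n)) →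
      (Fin ℓ → Fin m → ℝ) →L[ℝ] Fin k → EuclideanSpace ℝ (Fin ℓ) :=
    fun u => ContinuousLinearMap.pi fun i => evalMatrix m ℓ (f (φ u i.succ) - f (φ u 0))
  have hFfφ : ∀ i, ContDiffOn ℝ ∞ (fun u => F (f (φ u i))) O := fun i =>
    hF.comp (hfφ i) fun u _ => hfU _
  have hb : ContDiffOn ℝ ∞ b O := contDiffOn_pi.2 fun i => (hFfφ _).sub (hFfφ _)
  have hA : ContDiffOn ℝ ∞ A O := contDiffOn_clm_apply.2 fun α => contDiffOn_pi.2 fun i =>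
    ((evalMatrix m ℓ).contDiff.comp_contDiffOn ((hfφ _).sub (hfφ _))).clm_apply contDiffOn_const
  have hbA : ∀ α u, b u + A u α = fun i : Fin k => G α (φ u i.succ) - G α (φ u 0) := by
    intro α u
    ext1 i
    simp only [b, A, Pi.add_apply, ContinuousLinearMap.pi_apply, evalMatrix_apply, G, comp_apply,
      linPerturb]
    rw [map_sub]
    abel
  refine ⟨(univ.pi fun i => (e i).source) ×ˢ univ, ?_, measure_mono_null ?_
    (measure_affine_nontransverse_eq_zero volume hO hb hA
      fun u hu => surjective_pi_evalMatrix (hind _ hu.2))⟩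
  · refine prod_mem_nhds (set_pi_mem_nhds finite_univ fun i _ => ?_) univ_mem
    exact extChartAt_source_mem_nhds _
  rintro _ ⟨⟨q, α⟩, ⟨⟨hq, hqt⟩, hqe, -⟩, rfl⟩
  simp only [TransverseAt, Classical.not_imp] at hqt
  obtain ⟨⟨y, hy⟩, hnt⟩ := hqt
  have hqe' : ∀ i, q i ∈ (e i).source := fun i => hqe i (mem_univ i)
  let u : Fin (k + 1) → EuclideanSpace ℝ (Fin n) := fun i => e i (q i)
  have hut : ∀ i, u i ∈ (e i).target := fun i => (e i).map_source (hqe' i)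
  have hsymm : ∀ i, (e i).symm (u i) = q i := fun i => (e i).left_inv (hqe' i)
  have hφu : φ u = q := funext hsymm
  refine ⟨u, ⟨fun i _ => hut i, by rwa [mem_preimage, hφu]⟩, ?_, fun hs => hnt ?_⟩
  · rw [hbA, hφu]
    ext1 i
    have h1 : ∀ j, G α (q j) = y := fun j => congrFun hy j
    simp [h1]
  · have hGd : ∀ i, MDifferentiableAt I 𝓘(ℝ, EuclideanSpace ℝ (Fin ℓ)) (G α) (q i) := fun i =>
      (hG α (q i)).mdifferentiableAt (by simp)
    have hed : ∀ i, MDifferentiableAt I I (e i).symm (u i) := fun i =>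
      ((contMDiffOn_extChartAt_symm (n := ∞) (p₀.1 i)).contMDiffAt
        ((isOpen_extChartAt_target _).mem_nhds (hut i))).mdifferentiableAt (by simp)
    -- The chain rule compares the derivatives in the charts around `p₀` with those in the preferred
    -- charts at `q`, which enter `derivAt`.
    let E' : ∀ i, EuclideanSpace ℝ (Fin n) →L[ℝ] EuclideanSpace ℝ (Fin n) := fun i =>
      mfderiv I I (e i).symm (u i)
    have hγ : ∀ i, HasFDerivAt (fun x => G α ((e i).symm x)) ((derivAt I (G α) (q i)).comp (E' i))
        (u i) := fun i => by
      have h1 : HasMFDerivAt I 𝓘(ℝ, EuclideanSpace ℝ (Fin ℓ)) (G α) ((e i).symm (u i))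
          (derivAt I (G α) (q i)) := by
        have h2 := (hGd i).hasMFDerivAt
        rw [hsymm i]
        exact h2
      exact (h1.comp (u i) (hed i).hasMFDerivAt).hasFDerivAt
    have hd : HasFDerivAt (fun u => b u + A u α) (ContinuousLinearMap.pi fun i : Fin k =>
        ((derivAt I (G α) (q i.succ)).comp (E' i.succ)).comp (ContinuousLinearMap.proj i.succ) -
        ((derivAt I (G α) (q 0)).comp (E' 0)).comp (ContinuousLinearMap.proj 0)) u := by
      have h1 : (fun u => b u + A u α) = fun u (i : Fin k) => G α (φ u i.succ) - G α (φ u 0) :=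
        funext (hbA α)
      have h2 : ∀ i, HasFDerivAt (fun u => G α (φ u i))
          (((derivAt I (G α) (q i)).comp (E' i)).comp (ContinuousLinearMap.proj i)) u := fun i =>
        HasFDerivAt.comp (f := fun u : Fin (k + 1) → EuclideanSpace ℝ (Fin n) => u i) u (hγ i)
          (hasFDerivAt_apply i u)
      rw [h1, hasFDerivAt_pi]
      exact fun i => (h2 i.succ).sub (h2 0)
    rw [hd.fderiv] at hs
    rw [eq_top_iff]
    rintro Y -
    obtain ⟨w, hw⟩ := hs fun i => Y i.succ - Y 0
    let z : Fin (k + 1) → EuclideanSpace ℝ (Fin ℓ) := fun i => derivAt I (G α) (q i) (E' i (w i))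
    have hz : ∀ i : Fin k, z i.succ - z 0 = Y i.succ - Y 0 := fun i => congrFun hw i
    refine Submodule.mem_sup.2 ⟨z, ⟨fun i => E' i (w i), funext fun i => derivAt_multiMap hGd _ i⟩,
      fun _ => Y 0 - z 0, ⟨_, rfl⟩, ?_⟩
    ext1 i
    refine Fin.cases ?_ (fun i => ?_) i
    · simp
    · rw [Pi.add_apply, ← sub_eq_zero, ← sub_eq_zero.2 (hz i)]
      abel

end Perturbation

/-! ### The number `s_f` and avoidance of the diagonal -/

theorem infinite_of_chartedSpace_euclideanSpace {n : ℕ} (hn : 0 < n) (N : Type*)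
    [TopologicalSpace N] [Nonempty N] [ChartedSpace (EuclideanSpace ℝ (Fin n)) N] :
    Infinite N := by
  obtain ⟨x⟩ := ‹Nonempty N›
  let e := chartAt (EuclideanSpace ℝ (Fin n)) x
  have : Nonempty (Fin n) := ⟨⟨0, hn⟩⟩
  have : Nontrivial (EuclideanSpace ℝ (Fin n)) := inferInstance
  have h1 : e.target.Infinite :=
    infinite_of_mem_nhds (e x) (e.open_target.mem_nhds (mem_chart_target _ x))
  have h2 := h1.image e.symm.injOn
  exact infinite_univ_iff.1 (h2.mono (subset_univ _))

/-- A `(k + 1)`-tuple of distinct points of an infinite set extends to a longer one. -/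
theorem linearIndependent_sub_of_le {N E : Type*} [Infinite N] [AddCommGroup E] [Module ℝ E]
    {f : N → E} {k k' : ℕ} (hk : k ≤ k')
    (h : ∀ q ∈ distinctTuples N (k' + 1),
      LinearIndependent ℝ fun i : Fin k' => f (q i.succ) - f (q 0)) :
    ∀ q ∈ distinctTuples N (k + 1),
      LinearIndependent ℝ fun i : Fin k => f (q i.succ) - f (q 0) := by
  induction k', hk using Nat.le_induction with
  | base => exact h
  | succ k' _ ih =>
    refine ih fun q hq => ?_
    obtain ⟨x, hx⟩ := (finite_range q).infinite_compl.nonempty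
    have hinj : Injective (Fin.snoc q x : Fin (k' + 1 + 1) → N) :=
      Fin.snoc_injective_iff.2 ⟨fun i j hij => not_imp_not.1 (hq i j) hij, hx⟩
    have h1 := (h _ fun i j hij => hinj.ne hij).comp _ (Fin.castSucc_injective k')
    convert h1 using 1
    funext i
    have h0 : (Fin.snoc q x : Fin (k' + 1 + 1) → N) 0 = q 0 :=
      Fin.snoc_castSucc (α := fun _ => N) (p := q) (x := x) (i := 0)
    simp only [comp_apply, Fin.succ_castSucc, Fin.snoc_castSucc, h0]

/-- The supremum in the definition of `sMax f` is attained. -/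
theorem exists_sMax_eq {N : Type*} [Infinite N] {m : ℕ} (f : N → EuclideanSpace ℝ (Fin m)) :
    ∃ k, sMax f = k + 1 ∧ ∀ q ∈ distinctTuples N (k + 1),
      LinearIndependent ℝ fun i : Fin k => f (q i.succ) - f (q 0) := by
  have hmem := Nat.sSup_mem (s := {s : ℕ | ∃ k : ℕ, s = k + 1 ∧ ∀ q ∈ distinctTuples N (k + 1),
    finrank ℝ (Submodule.span ℝ (range fun i : Fin k => f (q i.succ) - f (q 0))) = k})
    ⟨1, 0, rfl, fun q _ => by simp⟩ ⟨m + 1, ?_⟩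
  · obtain ⟨k, hk, h⟩ := hmem
    refine ⟨k, hk, fun q hq => linearIndependent_iff_card_eq_finrank_span.2 ?_⟩
    rw [Fintype.card_fin]
    exact (h q hq).symm
  · rintro _ ⟨k, rfl, h⟩
    let q : Fin (k + 1) → N := fun i => Infinite.natEmbedding N i
    have h1 := h q fun i j hij hq =>
      hij (Fin.ext ((Infinite.natEmbedding N).injective hq))
    have h2 := Submodule.finrank_le
      (Submodule.span ℝ (range fun i : Fin k => f (q i.succ) - f (q 0)))
    rw [h1, finrank_euclideanSpace_fin] at h2
    omega

theorem finrank_diagonalSubspace_le (V : Type*) [AddCommGroup V] [Module ℝ V]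
    [FiniteDimensional ℝ V] (s : ℕ) : finrank ℝ (diagonalSubspace V s) ≤ finrank ℝ V := by
  have h : diagonalSubspace V s ≤
      LinearMap.range (LinearMap.pi fun _ : Fin s => (LinearMap.id : V →ₗ[ℝ] V)) := by
    rintro _ ⟨y, rfl⟩
    exact ⟨y, rfl⟩
  exact (Submodule.finrank_mono h).trans (LinearMap.finrank_range_le _)

/-- Transversality to the diagonal at a point of the diagonal needs
`n (k + 1) + ℓ ≥ (k + 1) ℓ`. -/
theorem TransverseAt.notMem_diagonalSubspace {n ℓ : ℕ} {N : Type*} [TopologicalSpace N]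
    [ChartedSpace (EuclideanSpace ℝ (Fin n)) N] {k : ℕ} (hlt : n * (k + 1) < k * ℓ)
    {G : (Fin (k + 1) → N) → Fin (k + 1) → EuclideanSpace ℝ (Fin ℓ)} {q : Fin (k + 1) → N}
    (h : TransverseAt (prodModel n (k + 1)) G
      (diagonalSubspace (EuclideanSpace ℝ (Fin ℓ)) (k + 1)) q) :
    G q ∉ diagonalSubspace (EuclideanSpace ℝ (Fin ℓ)) (k + 1) := by
  intro hmem
  have h1 := h hmem
  have h2 := Submodule.finrank_add_le_finrank_add_finrank
    (LinearMap.range (derivAt (prodModel n (k + 1)) G q).toLinearMap)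
    (diagonalSubspace (EuclideanSpace ℝ (Fin ℓ)) (k + 1))
  rw [h1, finrank_top, finrank_pi_fintype] at h2
  have h3 := LinearMap.finrank_range_le (derivAt (prodModel n (k + 1)) G q).toLinearMap
  rw [finrank_pi_fintype] at h3
  have h4 := finrank_diagonalSubspace_le (EuclideanSpace ℝ (Fin ℓ)) (k + 1)
  simp only [finrank_euclideanSpace_fin, Finset.sum_const, Finset.card_univ, Fintype.card_fin,
    smul_eq_mul] at h2 h3 h4
  nlinarith

theorem proposition5p2 (n m ℓ : ℕ) (hn : 0 < n) (hm : 0 < m) (hℓ : 0 < ℓ)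
    (N : Type*) [TopologicalSpace N] [T2Space N] [SecondCountableTopology N] [Nonempty N]
    [ChartedSpace (EuclideanSpace ℝ (Fin n)) N]
    [IsManifold 𝓘(ℝ, EuclideanSpace ℝ (Fin n)) ∞ N]
    (U : Set (EuclideanSpace ℝ (Fin m))) (hU : IsOpen U)
    (f : N → EuclideanSpace ℝ (Fin m))
    (hf : ContMDiff 𝓘(ℝ, EuclideanSpace ℝ (Fin n)) 𝓘(ℝ, EuclideanSpace ℝ (Fin m)) ∞ f)
    (hfU : ∀ q, f q ∈ U) (hfinj : Injective f)
    (F : EuclideanSpace ℝ (Fin m) → EuclideanSpace ℝ (Fin ℓ)) (hF : ContDiffOn ℝ ∞ F U)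
    (hs : ((sMax f : ℤ) - 1) * (ℓ : ℤ) > (n : ℤ) * (sMax f : ℤ)) :
    ∃ S : Set (EuclideanSpace ℝ (Fin m) →ₗ[ℝ] EuclideanSpace ℝ (Fin ℓ)),
      LebesgueNull S ∧
      ∀ π : EuclideanSpace ℝ (Fin m) →ₗ[ℝ] EuclideanSpace ℝ (Fin ℓ), π ∉ S →
        HasNormalCrossings n (linPerturb F π ∘ f) ∧
        multiMap (linPerturb F π ∘ f) (sMax f) '' distinctTuples N (sMax f) ∩
          (diagonalSubspace (EuclideanSpace ℝ (Fin ℓ)) (sMax f) : Set (Fin (sMax f) → _)) = ∅ := by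
  have hinf := infinite_of_chartedSpace_euclideanSpace hn N
  obtain ⟨K, hK, hind⟩ := exists_sMax_eq f
  generalize sMax f = s at hs hK ⊢
  subst hK
  have hlt : n * (K + 1) < K * ℓ := by
    push_cast at hs
    rw [add_sub_cancel_right] at hs
    exact_mod_cast hs
  refine ⟨{π | ∃ k ≤ K, ∃ q ∈ distinctTuples N (k + 1),
    ¬TransverseAt (prodModel n (k + 1)) (multiMap (linPerturb F π ∘ f) (k + 1))
      (diagonalSubspace (EuclideanSpace ℝ (Fin ℓ)) (k + 1)) q}, ?_, fun π hπ => ?_⟩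
  · refine measure_mono_null ?_ (measure_iUnion_null fun k : Fin (K + 1) =>
      measure_nontransverse_eq_zero (k := k) hU hf hfU hF
        (linearIndependent_sub_of_le (Nat.lt_succ_iff.1 k.2) hind))
    rintro α ⟨k, hk, h⟩
    exact mem_iUnion.2 ⟨⟨k, Nat.lt_succ_of_le hk⟩, h⟩
  · have htr : ∀ k ≤ K, ∀ q ∈ distinctTuples N (k + 1), TransverseAt (prodModel n (k + 1))
        (multiMap (linPerturb F π ∘ f) (k + 1))
        (diagonalSubspace (EuclideanSpace ℝ (Fin ℓ)) (k + 1)) q := by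
      intro k hk q hq
      by_contra h
      exact hπ ⟨k, hk, q, hq, h⟩
    have hmiss : ∀ q ∈ distinctTuples N (K + 1), multiMap (linPerturb F π ∘ f) (K + 1) q ∉
        diagonalSubspace (EuclideanSpace ℝ (Fin ℓ)) (K + 1) := fun q hq =>
      (htr K le_rfl q hq).notMem_diagonalSubspace hlt
    refine ⟨fun s hs2 q hq => ?_, ?_⟩
    · rcases le_or_gt s (K + 1) with hsK | hsK
      · obtain ⟨k, rfl⟩ : ∃ k, s = k + 1 := ⟨s - 1, by omega⟩
        exact htr k (by omega) q hq
      · -- The first `K + 1` values already differ, so the condition is vacuous.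
        rintro ⟨y, hy⟩
        refine absurd ⟨y, funext fun i => congrFun hy (Fin.castLE hsK.le i)⟩
          (hmiss (fun i => q (Fin.castLE hsK.le i)) fun i j hij => hq _ _ ?_)
        exact (Fin.castLE_injective hsK.le).ne hij
    · rw [eq_empty_iff_forall_notMem]
      rintro _ ⟨⟨q, hq, rfl⟩, hmem⟩
      exact hmiss q hq hmem
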